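/- **Setting.** Let $\alpha\ge 0$ and $\beta\ge\alpha+1$ be integers, and let $\mu$ be a probability measure on $\mathbb R^D$ with support $M$. For $y\in M$ let $T_yM\subset\mathbb R^D$ be the tangent space, let $\pi_y(x)=\mathrm{pr}_{T_yM}(x-y)$, and let $$\tau=\sup\{\varepsilon:\ \text{every } x \text{ with } \mathrm{dist}(x,M)<\varepsilon \text{ has a unique nearest point in } M\}$$ be the reach of $M$. Let $\Phi_y:B_{T_yM}(0,\tau/8)\to M\cap B(y,\tau/4)$, $\Phi_y(0)=y$, be the inverse of the restriction of $\pi_y$ to $M\cap B(y,\tau/4)$. Write $\|f\|_{C^k(U)}=\max_{0\le i\le k}\sup_{z\in U}\|d^if(z)\|_{op}$, and let $dy$ and $\mathrm{Vol}$ denote the $d$-dimensional volume (the Hausdorff measure normalized to agree with Lebesgue measure on $\mathbb R^d$) on $M$. Assume: 1. $M$ is a compact embedded $C^\beta$ submanifold (without boundary) of dimension $d\ge 3$, its reach satisfies $\tau>\tau_{\min}>0$, and there is $L_M>0$ with $\|\Phi_y\|_{C^\beta(B_{T_yM}(0,\tau/8))}\le L_M$ for all $y\in M$. 2. $\mu$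 has a $C^\alpha$ density $p$ with respect to $dy$ on $M$ with $0<p_{\min}\le p\le p_{\max}$, and there is $L_\mu$ with $\|p\circ\Phi_y\|_{C^\alpha(B_{T_yM}(0,\tau/8))}\le L_\mu$ for all $y\in M$. 3. $C_{\log}>\max(d,4)$ is a constant such that $e^{-C_{\log}}<p(y)<e^{C_{\log}}$ for all $y\in M$, $\log \mathrm{Vol}\,M<e^{C_{\log}}$, and $\min(\tau,L_M^{-1})\ge e^{-C_{\log}}$. Let $X$ be the Ornstein–Uhlenbeck process $dX(t)=-X(t)\,dt+\sqrt2\,dB(t)$ with $X(0)\sim\mu$, put $c_t=e^{-t}$ and $\sigma_t=\sqrt{1-e^{-2t}}$, and let $$p(y\,|\,t,x)=\frac{e^{-\|x-c_ty\|^2/2\sigma_t^2}\,p(y)}{\int_M e^{-\|x-c_ty'\|^2/2\sigma_t^2}\,p(y')\,dy'}$$ be the density with respect to $dy$ of $X(0)$ conditioned on $X(t)=x$. Write $\log_+u=\max(\log u,0)$. **Proposition.** For all $t>0$ and $\delta>0$, with probability at least $1-\delta$ the following holds simultaneously for all $y\in M$: $$-20d\left(\log_+\big((\sigma_t/c_t)^{-1}\big)+4C_{\log}\right)-8\log\delta^{-1}-\tfrac34(c_t/\sigma_t)^2\|X(0)-y\|^2\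 \le\ \log p(y\,|\,t,X(t))$$ $$\le\ 20d\left(\log_+\big((\sigma_t/c_t)^{-1}\big)+4C_{\log}\right)+8\log\delta^{-1}-\tfrac14(c_t/\sigma_t)^2\|X(0)-y\|^2 .$$ -/

import Mathlib

open MeasureTheory ProbabilityTheory
open scoped NNReal ENNReal

namespace DiffusionManifold

noncomputable section

/-! ### Embedded manifolds in `ℝ^D` -/

/-- `M ⊆ ℝ^D` is an embedded `d`-dimensional submanifold (without boundary) of class `C^k`: around
each point it is the image of an open subset of `ℝ^d` under a `C^k` immersion that is a
homeomorphism onto its image. -/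
def IsSubmanifold {D : ℕ} (k d : ℕ) (M : Set (EuclideanSpace ℝ (Fin D))) : Prop :=
  ∀ y ∈ M, ∃ (U : Set (EuclideanSpace ℝ (Fin d)))
    (φ : EuclideanSpace ℝ (Fin d) → EuclideanSpace ℝ (Fin D))
    (V : Set (EuclideanSpace ℝ (Fin D))),
    IsOpen U ∧ 0 ∈ U ∧ φ 0 = y ∧ IsOpen V ∧ φ '' U = M ∩ V ∧
    ContDiffOn ℝ k φ U ∧ (∀ z ∈ U, Function.Injective (fderiv ℝ φ z)) ∧
    Topology.IsEmbedding (U.domRestrict φ)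

/-- The tangent space `T_y M`, a linear subspace of `ℝ^D`. -/
def tangentSpaceAt {D : ℕ} (M : Set (EuclideanSpace ℝ (Fin D))) (y : EuclideanSpace ℝ (Fin D)) :
    Submodule ℝ (EuclideanSpace ℝ (Fin D)) :=
  Submodule.span ℝ (tangentConeAt ℝ M y)

/-- The reach: the supremum of all `ε` such that every point at distance less than `ε` from `M`
has a unique nearest point in `M`. -/
def reach {D : ℕ} (M : Set (EuclideanSpace ℝ (Fin D))) : ℝ :=
  sSup {ε : ℝ | ∀ x, Metric.infDist x M < ε → ∃! y, y ∈ M ∧ Metric.infDist x M = dist x y}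

/-- The projection `π_y`, the orthogonal projection onto the tangent space at `y`, with `y` as
origin. -/
def tangentProj {D : ℕ} (M : Set (EuclideanSpace ℝ (Fin D))) (y x : EuclideanSpace ℝ (Fin D)) :
    tangentSpaceAt M y :=
  (tangentSpaceAt M y).orthogonalProjectionOnto (x - y)

/-- `Φ` is the inverse projection function `Φ_y` at `y`: on the ball `B_{T_y M}(0, τ/8)` it is an
inverse of the restriction of `π_y` to `M ∩ B(y, τ/4)`, with `Φ_y(0) = y`. Here `τ` is the
reach of `M`. -/
structure IsInverseProjection {D : ℕ} (M : Set (EuclideanSpace ℝ (Fin D)))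
    (y : EuclideanSpace ℝ (Fin D)) (Φ : tangentSpaceAt M y → EuclideanSpace ℝ (Fin D)) :
    Prop where
  map_zero : Φ 0 = y
  mapsTo : ∀ z ∈ Metric.ball (0 : tangentSpaceAt M y) (reach M / 8),
    Φ z ∈ M ∩ Metric.ball y (reach M / 4)
  proj_apply : ∀ z ∈ Metric.ball (0 : tangentSpaceAt M y) (reach M / 8),
    tangentProj M y (Φ z) = z

/-- On the open set `Ω` the function `f` is of class `C^k`, and
`‖f‖_{C^k(Ω)} = max_{0 ≤ i ≤ k} sup_{z ∈ Ω} ‖d^i f(z)‖_op ≤ L`. -/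
def CkNormLe {F G : Type*} [NormedAddCommGroup F] [NormedSpace ℝ F] [NormedAddCommGroup G]
    [NormedSpace ℝ G] (k : ℕ) (f : F → G) (Ω : Set F) (L : ℝ) : Prop :=
  ContDiffOn ℝ k f Ω ∧ ∀ i ≤ k, ∀ z ∈ Ω, ‖iteratedFDeriv ℝ i f z‖ ≤ L

/-! ### The assumptions on the manifold and on the measure -/

/-- `M` is a compact `C^β` manifold of dimension `d ≥ 3` and reach larger than `τmin > 0`, whose
inverse projection functions have `C^β` norm at most `LM`. -/
structure ManifoldAssumption {D : ℕ} (β d : ℕ) (τmin LM : ℝ)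
    (M : Set (EuclideanSpace ℝ (Fin D))) : Prop where
  isCompact : IsCompact M
  isSubmanifold : IsSubmanifold β d M
  three_le_dim : 3 ≤ d
  τmin_pos : 0 < τmin
  τmin_lt_reach : τmin < reach M
  LM_pos : 0 < LM
  inverseProjection : ∀ y ∈ M, ∃ Φ : tangentSpaceAt M y → EuclideanSpace ℝ (Fin D),
    IsInverseProjection M y Φ ∧
      CkNormLe β Φ (Metric.ball (0 : tangentSpaceAt M y) (reach M / 8)) LM

/-- `μ` has the density `p` with respect to the `d`-dimensional volume (the Hausdorff measure that
agrees with Lebesgue measure on `ℝ^d`) on its support `M`; the density is `C^α` with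
`pmin ≤ p ≤ pmax`, and has `C^α` norm at most `Lμ` in the inverse projection charts. -/
structure DensityAssumption {D : ℕ} (α d : ℕ) (pmin pmax Lμ : ℝ)
    (M : Set (EuclideanSpace ℝ (Fin D))) (p : EuclideanSpace ℝ (Fin D) → ℝ)
    (μ : Measure (EuclideanSpace ℝ (Fin D))) : Prop where
  support_eq : μ.support = M
  eq_withDensity : μ = (μHE[d].restrict M).withDensity fun y => ENNReal.ofReal (p y)
  continuousOn : ContinuousOn p M
  pmin_pos : 0 < pmin
  bounds : ∀ y ∈ M, pmin ≤ p y ∧ p y ≤ pmax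
  smooth : ∀ y ∈ M, ∀ Φ : tangentSpaceAt M y → EuclideanSpace ℝ (Fin D),
    IsInverseProjection M y Φ →
      CkNormLe α (p ∘ Φ) (Metric.ball (0 : tangentSpaceAt M y) (reach M / 8)) Lμ

/-- The constant `Clog` bounds the logarithmic complexity of the manifold and of the density. -/
structure LogComplexityAssumption {D : ℕ} (d : ℕ) (LM Clog : ℝ)
    (M : Set (EuclideanSpace ℝ (Fin D))) (p : EuclideanSpace ℝ (Fin D) → ℝ) : Prop where
  max_lt : max (d : ℝ) 4 < Clog
  density_bounds : ∀ y ∈ M, Real.exp (-Clog) < p y ∧ p y < Real.exp Clog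
  log_volume_lt : Real.log (μHE[d] M).toReal < Real.exp Clog
  exp_neg_le_min : Real.exp (-Clog) ≤ min (reach M) LM⁻¹

/-! ### The forward process and the posterior density -/

/-- `c_t = e^{-t}`. -/
def ct (t : ℝ) : ℝ := Real.exp (-t)

/-- `σ_t = √(1 - e^{-2t})`. -/
def sigmat (t : ℝ) : ℝ := Real.sqrt (1 - Real.exp (-2 * t))

/-- `X` is the forward process, i.e. the Ornstein–Uhlenbeck process `dX = -X dt + √2 dB` with
`X(0) ∼ μ`, given by its law: it has continuous paths, and for `s ≤ t` the noise
`X(t) - c_{t-s} X(s)` has the law of `σ_{t-s} Z` with `Z` standard normal, and is independent of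
`(X(r))_{r ≤ s}`. -/
structure IsForwardProcess {D : ℕ} {Ω : Type*} [MeasurableSpace Ω] (P : Measure Ω)
    (μ : Measure (EuclideanSpace ℝ (Fin D))) (X : ℝ≥0 → Ω → EuclideanSpace ℝ (Fin D)) :
    Prop where
  measurable : ∀ t, Measurable (X t)
  continuous_paths : ∀ᵐ ω ∂P, Continuous fun t => X t ω
  initial_law : P.map (X 0) = μ
  noise_law : ∀ s t : ℝ≥0, s ≤ t →
    P.map (fun ω => X t ω - ct (t - s) • X s ω) =
      (stdGaussian (EuclideanSpace ℝ (Fin D))).map fun z => sigmat (t - s) • z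
  noise_indep : ∀ s t : ℝ≥0, s ≤ t →
    Indep (MeasurableSpace.comap (fun ω => X t ω - ct (t - s) • X s ω) inferInstance)
      (⨆ r ∈ Set.Iic s, MeasurableSpace.comap (X r) inferInstance) P

/-- The density `p(y | t, x)` of `X(0)` given `X(t) = x` with respect to the volume on `M`. -/
def posteriorDensity {D : ℕ} (d : ℕ) (M : Set (EuclideanSpace ℝ (Fin D)))
    (p : EuclideanSpace ℝ (Fin D) → ℝ) (t : ℝ) (x y : EuclideanSpace ℝ (Fin D)) : ℝ :=
  Real.exp (-‖x - ct t • y‖ ^ 2 / (2 * sigmat t ^ 2)) * p y /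
    ∫ y' in M, Real.exp (-‖x - ct t • y'‖ ^ 2 / (2 * sigmat t ^ 2)) * p y' ∂μHE[d]

end

end DiffusionManifold

namespace DiffusionManifold

/-! ### Gaussian tails -/

section GaussianTail

variable {E : Type*} [NormedAddCommGroup E] [InnerProductSpace ℝ E] [FiniteDimensional ℝ E]
  [MeasurableSpace E] [BorelSpace E]

/-! Write X(t) = c x₀ + σ Z with x₀ = X(0), Z standard Gaussian independent of x₀, and put a = c/σ.
The exponent of the posterior is then -‖Z‖²/2 - a²‖x₀ - y‖²/2 - a⟨x₀ - y, Z⟩. The first term cancels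
against the normalising integral, so the ambient dimension D never enters. It remains to show a|⟨x₀
- y, Z⟩| ≤ a²‖x₀ - y‖²/4 + K for all y ∈ M at once: this turns the factor 1/2 into 1/4 and 3/4. The
normalising integral is then at most e^K and at least e^(-K-1) times the mass of a ball of radius of
order min(1, 1/a) around x₀, both up to the cancelling factor (`log_posteriorDensity_bounds`).

The uniform bound is a chaining argument (`measure_exists_abs_inner_gt_le`) over nets of M at scales
ε/2^k with aε ≤ 1/16. Increments inside the nets are deterministic; the first link x₀ - v is random
but independent of Z.

Both the net sizes and the lower bound on the integral come from one mass estimate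
(`ofReal_exp_neg_mul_pow_le_measure_ball`): orthogonal projection to a d-dimensional space of
tangent vectors is 1-Lipschitz and maps a piece of M onto a Euclidean ball, which bounds the volume
of that piece from below. -/

lemma stdGaussian_map_inner (u : E) :
    (stdGaussian E).map (fun z => inner ℝ u z) = gaussianReal 0 (‖u‖₊ ^ 2) := by
  have h := IsGaussian.map_eq_gaussianReal (μ := stdGaussian E) (innerSL ℝ u)
  have hv : (‖u‖ ^ 2).toNNReal = ‖u‖₊ ^ 2 := by
    rw [← coe_nnnorm, ← NNReal.coe_pow, Real.toNNReal_coe]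
  rw [integral_strongDual_stdGaussian, variance_dual_stdGaussian, innerSL_apply_norm, hv] at h
  exact h

lemma stdGaussian_inner_ge_le (u : E) (hu : u ≠ 0) {s : ℝ} (hs : 0 ≤ s) :
    stdGaussian E {z | ‖u‖ * s ≤ inner ℝ u z} ≤ ENNReal.ofReal (Real.exp (-(s ^ 2 / 2))) := by
  have hu' : 0 < ‖u‖ := norm_pos_iff.mpr hu
  have hmap := stdGaussian_map_inner u
  have hmeas : Measurable fun z : E => inner ℝ u z := by fun_prop
  have hint : Integrable (fun z => Real.exp (s / ‖u‖ * inner ℝ u z)) (stdGaussian E) := by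
    have h := integrable_exp_mul_gaussianReal (μ := 0) (v := ‖u‖₊ ^ 2) (s / ‖u‖)
    rw [← hmap] at h
    exact (integrable_map_measure (by fun_prop) hmeas.aemeasurable).mp h
  -- Chernoff bound; `s / ‖u‖` is the optimal parameter for variance `‖u‖ ^ 2`.
  have h := measure_ge_le_exp_mul_mgf (μ := stdGaussian E) (X := fun z => inner ℝ u z)
    (t := s / ‖u‖) (‖u‖ * s) (by positivity) hint
  rw [mgf_gaussianReal hmap, ← Real.exp_add] at h
  rw [← ofReal_measureReal]
  refine ENNReal.ofReal_le_ofReal (h.trans (Real.exp_le_exp.mpr (le_of_eq ?_)))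
  push_cast
  field_simp
  ring

lemma stdGaussian_abs_inner_gt_le (u : E) {s : ℝ} (hs : 0 ≤ s) :
    stdGaussian E {z | ‖u‖ * s < |inner ℝ u z|}
      ≤ ENNReal.ofReal (2 * Real.exp (-(s ^ 2 / 2))) := by
  rcases eq_or_ne u 0 with rfl | hu
  · simp
  have hsub : {z : E | ‖u‖ * s < |inner ℝ u z|} ⊆
      {z | ‖u‖ * s ≤ inner ℝ u z} ∪ {z | ‖-u‖ * s ≤ inner ℝ (-u) z} := by
    intro z hz
    rcases lt_abs.mp (show ‖u‖ * s < |inner ℝ u z| from hz) with h | h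
    · exact Or.inl h.le
    · right
      simpa using h.le
  refine (measure_mono hsub).trans ((measure_union_le _ _).trans ?_)
  rw [two_mul, ENNReal.ofReal_add (by positivity) (by positivity)]
  exact add_le_add (stdGaussian_inner_ge_le u hu hs)
    (stdGaussian_inner_ge_le (-u) (neg_ne_zero.mpr hu) hs)

/-- The Gaussian tail bound in a random direction `U` that is independent of the Gaussian `Z`. -/
lemma measure_abs_inner_gt_le {Ω : Type*} [MeasurableSpace Ω] {P : Measure Ω}
    [IsProbabilityMeasure P] {U Z : Ω → E} (hU : Measurable U) (hZ : Measurable Z)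
    (hUZ : IndepFun U Z P) (hZlaw : P.map Z = stdGaussian E) {s : ℝ} (hs : 0 ≤ s) :
    P {ω | ‖U ω‖ * s < |inner ℝ (U ω) (Z ω)|}
      ≤ ENNReal.ofReal (2 * Real.exp (-(s ^ 2 / 2))) := by
  have hS : MeasurableSet {q : E × E | ‖q.1‖ * s < |inner ℝ q.1 q.2|} :=
    measurableSet_lt (by fun_prop) (by fun_prop)
  have hprob : IsProbabilityMeasure (P.map U) := Measure.isProbabilityMeasure_map hU.aemeasurable
  have h1 : P {ω | ‖U ω‖ * s < |inner ℝ (U ω) (Z ω)|} =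
      (P.map fun ω => (U ω, Z ω)) {q : E × E | ‖q.1‖ * s < |inner ℝ q.1 q.2|} := by
    rw [Measure.map_apply (hU.prodMk hZ) hS]
    rfl
  -- By independence the joint law is a product, and Fubini reduces to a fixed direction.
  rw [h1, (indepFun_iff_map_prod_eq_prod_map_map hU.aemeasurable hZ.aemeasurable).mp hUZ, hZlaw,
    Measure.prod_apply hS]
  calc ∫⁻ u, stdGaussian E (Prod.mk u ⁻¹' {q : E × E | ‖q.1‖ * s < |inner ℝ q.1 q.2|}) ∂P.map U
      ≤ ∫⁻ _, ENNReal.ofReal (2 * Real.exp (-(s ^ 2 / 2))) ∂P.map U :=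
        lintegral_mono fun u => stdGaussian_abs_inner_gt_le u hs
    _ = ENNReal.ofReal (2 * Real.exp (-(s ^ 2 / 2))) := by simp

end GaussianTail

/-! ### Nets in sets whose balls carry mass -/

/-- Balls of half the separation are disjoint, so their masses add up to at most 1. -/
lemma card_mul_le_one_of_separated {E : Type*} [PseudoMetricSpace E] [MeasurableSpace E]
    [OpensMeasurableSpace E] {μ : Measure E} [IsProbabilityMeasure μ] {M : Set E} {r m : ℝ}
    (hm : ∀ y ∈ M, ENNReal.ofReal m ≤ μ (Metric.ball y (r / 2))) {N : Finset E}
    (hNM : ↑N ⊆ M) (hN : (N : Set E).Pairwise fun u v => r ≤ dist u v) :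
    (N.card : ℝ) * m ≤ 1 := by
  have hdisj : (N : Set E).PairwiseDisjoint fun v => Metric.ball v (r / 2) := by
    intro u hu v hv huv
    exact Metric.ball_disjoint_ball (by linarith [hN hu hv huv])
  have h : ∑ v ∈ N, ENNReal.ofReal m ≤ 1 :=
    calc ∑ v ∈ N, ENNReal.ofReal m ≤ ∑ v ∈ N, μ (Metric.ball v (r / 2)) :=
          Finset.sum_le_sum fun v hv => hm v (hNM hv)
      _ = μ (⋃ v ∈ N, Metric.ball v (r / 2)) :=
          (measure_biUnion_finset hdisj fun v _ => Metric.isOpen_ball.measurableSet).symm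
      _ ≤ 1 := prob_le_one
  rw [Finset.sum_const, nsmul_eq_mul, ← ENNReal.ofReal_natCast,
    ← ENNReal.ofReal_mul (by positivity), ← ENNReal.ofReal_one] at h
  exact (ENNReal.ofReal_le_ofReal_iff zero_le_one).mp h

/-- A separated set of maximal cardinality is a net, since an uncovered point could be added to it.
The packing bound guarantees that a maximum exists. -/
lemma exists_finset_net {E : Type*} [PseudoMetricSpace E] [MeasurableSpace E]
    [OpensMeasurableSpace E] {μ : Measure E} [IsProbabilityMeasure μ] {M : Set E} {r m : ℝ}
    (hm0 : 0 < m) (hm : ∀ y ∈ M, ENNReal.ofReal m ≤ μ (Metric.ball y (r / 2))) (hr : 0 < r) :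
    ∃ N : Finset E, ↑N ⊆ M ∧ (∀ y ∈ M, ∃ v ∈ N, dist y v ≤ r) ∧ (N.card : ℝ) * m ≤ 1 := by
  classical
  let Q : ℕ → Prop := fun n => ∃ N : Finset E, ↑N ⊆ M ∧
    (N : Set E).Pairwise (fun u v => r ≤ dist u v) ∧ N.card = n
  have hbound : ∀ n, Q n → n ≤ ⌊1 / m⌋₊ := by
    rintro n ⟨N, h1, h2, rfl⟩
    exact Nat.le_floor (by rw [le_div_iff₀ hm0]; exact card_mul_le_one_of_separated hm h1 h2)
  have hQ0 : Q 0 := ⟨∅, by simp, by simp, rfl⟩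
  obtain ⟨N, hNM, hsep, hcard⟩ : Q (Nat.findGreatest Q ⌊1 / m⌋₊) :=
    Nat.findGreatest_spec (Nat.zero_le _) hQ0
  refine ⟨N, hNM, fun y hy => ?_, card_mul_le_one_of_separated hm hNM hsep⟩
  by_contra! hfar
  have hyN : y ∉ N := fun h => absurd (hfar y h) (by simp [hr.le])
  have hQ : Q (N.card + 1) := by
    refine ⟨insert y N, ?_, ?_, Finset.card_insert_of_notMem hyN⟩
    · rw [Finset.coe_insert]
      exact Set.insert_subset hy hNM
    · rw [Finset.coe_insert]
      refine hsep.insert fun v hv _ => ⟨(hfar v hv).le, ?_⟩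
      rw [dist_comm]
      exact (hfar v hv).le
  have := Nat.le_findGreatest (hbound _ hQ) hQ
  omega

/-! ### Chaining -/

/-- A vector whose increments along the parent map of a chain of nets are controlled has controlled
increments from the coarsest net. -/
lemma exists_root_of_increments {E : Type*} [NormedAddCommGroup E] [InnerProductSpace ℝ E]
    {N : ℕ → Finset E} {par : ℕ → E → E} {ε : ℝ} {s : ℕ → ℝ} (hs : ∀ k, 0 ≤ s k)
    (hpar : ∀ k, ∀ v ∈ N (k + 1), par k v ∈ N k ∧ ‖par k v - v‖ ≤ ε / 2 ^ k) {z : E}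
    (hz : ∀ k, ∀ v ∈ N (k + 1), |inner ℝ (par k v - v) z| ≤ ‖par k v - v‖ * s (k + 1)) (n : ℕ) :
    ∀ v ∈ N n, ∃ u ∈ N 0, ‖u - v‖ ≤ 2 * ε * (1 - 1 / 2 ^ n) ∧
      |inner ℝ (u - v) z| ≤ ∑ k ∈ Finset.range n, ε / 2 ^ k * s (k + 1) := by
  induction n with
  | zero => exact fun v hv => ⟨v, hv, by simp, by simp⟩
  | succ n ih =>
    intro v hv
    obtain ⟨hp, hd⟩ := hpar n v hv
    obtain ⟨u, hu, h1, h2⟩ := ih _ hp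
    have hsplit : u - v = (u - par n v) + (par n v - v) := by abel
    refine ⟨u, hu, ?_, ?_⟩
    · rw [hsplit]
      refine (norm_add_le _ _).trans ((add_le_add h1 hd).trans (le_of_eq ?_))
      rw [pow_succ]
      field_simp
      ring
    · rw [hsplit, inner_add_left, Finset.sum_range_succ]
      refine (abs_add_le _ _).trans (add_le_add h2 ((hz n v hv).trans ?_))
      exact mul_le_mul_of_nonneg_right hd (hs _)

lemma sum_range_add_ten_div_two_pow (n : ℕ) :
    ∑ k ∈ Finset.range n, ((k : ℝ) + 10) / 2 ^ k = 22 - (2 * n + 22) / 2 ^ n := by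
  induction n with
  | zero => simp
  | succ n ih =>
    rw [Finset.sum_range_succ, ih, pow_succ]
    push_cast
    field_simp
    ring

/-- The truncation level at scale `k` of the chaining argument. -/
noncomputable def chainLevel (d : ℕ) (H : ℝ) (k : ℕ) : ℝ :=
  Real.sqrt (2 * (H + (k + 1) * (d + 2)))

lemma chainLevel_sq {d : ℕ} {H : ℝ} (hH : 0 ≤ H) (k : ℕ) :
    chainLevel d H k ^ 2 = 2 * (H + (k + 1) * (d + 2)) :=
  Real.sq_sqrt (by positivity)

lemma chainLevel_nonneg (d : ℕ) (H : ℝ) (k : ℕ) : 0 ≤ chainLevel d H k := Real.sqrt_nonneg _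

lemma one_le_chainLevel {d : ℕ} {H : ℝ} (hH : 0 ≤ H) (k : ℕ) : 1 ≤ chainLevel d H k := by
  refine Real.one_le_sqrt.mpr ?_
  have : (0 : ℝ) ≤ k * d := by positivity
  have : (0 : ℝ) ≤ k := by positivity
  have : (0 : ℝ) ≤ d := by positivity
  nlinarith

lemma chainLevel_sq_le {d : ℕ} {H : ℝ} (hd : 3 ≤ d) (hH : 16 * d ≤ H) (k : ℕ) :
    chainLevel d H k ^ 2 ≤ H / 4 * (k + 9) := by
  have hd' : (3 : ℝ) ≤ d := by exact_mod_cast hd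
  rw [chainLevel_sq (by linarith)]
  have hk : (0 : ℝ) ≤ k := by positivity
  nlinarith [mul_le_mul_of_nonneg_left (show (d : ℝ) + 2 ≤ H / 8 by linarith)
    (show (0 : ℝ) ≤ k + 1 by linarith)]

/-- Levels are at least 1, hence bounded by their squares, which grow only linearly in the scale
index; the geometric weights then sum to at most 22, and 22/4 = 11/2. -/
lemma sum_chainLevel_le {d : ℕ} {H ε : ℝ} (hd : 3 ≤ d) (hH : 16 * d ≤ H) (hε : 0 ≤ ε) (n : ℕ) :
    ∑ k ∈ Finset.range n, ε / 2 ^ k * chainLevel d H (k + 1) ≤ ε * (11 / 2 * H) := by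
  have hH0 : 0 ≤ H := le_trans (by positivity) hH
  calc ∑ k ∈ Finset.range n, ε / 2 ^ k * chainLevel d H (k + 1)
      ≤ ∑ k ∈ Finset.range n, ε * (H / 4) * (((k : ℝ) + 10) / 2 ^ k) := by
        refine Finset.sum_le_sum fun k _ => ?_
        have h1 := one_le_chainLevel (d := d) hH0 (k + 1)
        have h2 := chainLevel_sq_le hd hH (k + 1)
        have h3 : chainLevel d H (k + 1) ≤ H / 4 * (k + 10) := by
          push_cast at h2
          nlinarith
        calc ε / 2 ^ k * chainLevel d H (k + 1) ≤ ε / 2 ^ k * (H / 4 * (k + 10)) := by gcongr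
          _ = ε * (H / 4) * (((k : ℝ) + 10) / 2 ^ k) := by ring
    _ = ε * (H / 4) * (22 - (2 * n + 22) / 2 ^ n) := by
        rw [← Finset.mul_sum, sum_range_add_ten_div_two_pow]
    _ ≤ ε * (H / 4) * 22 := by
        gcongr
        have : (0 : ℝ) ≤ (2 * n + 22) / 2 ^ n := by positivity
        linarith
    _ = ε * (11 / 2 * H) := by ring

/-- Control of the increments along a chain of nets, and of those from `x` to the coarsest net,
bounds the linear functional given by `z` on `x - M`. -/
lemma abs_inner_le_of_chain {E : Type*} [NormedAddCommGroup E] [InnerProductSpace ℝ E]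
    {M : Set E} {N : ℕ → Finset E} {par : ℕ → E → E} {d : ℕ} {a ε H : ℝ} (hd : 3 ≤ d)
    (hH : 16 * d ≤ H) (ha : 0 ≤ a) (hε : 0 ≤ ε) (haε : a * ε ≤ 1 / 16)
    (hcover : ∀ k, ∀ y ∈ M, ∃ v ∈ N k, dist y v ≤ ε / 2 ^ k)
    (hpar : ∀ k, ∀ v ∈ N (k + 1), par k v ∈ N k ∧ ‖par k v - v‖ ≤ ε / 2 ^ k) {x z : E}
    (hroot : ∀ v ∈ N 0, |inner ℝ (x - v) z| ≤ ‖x - v‖ * chainLevel d H 0)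
    (hz : ∀ k, ∀ v ∈ N (k + 1),
      |inner ℝ (par k v - v) z| ≤ ‖par k v - v‖ * chainLevel d H (k + 1)) :
    ∀ y ∈ M, a * |inner ℝ (x - y) z| ≤ 1 / 4 * a ^ 2 * ‖x - y‖ ^ 2 + 4 * H := by
  have hH0 : 0 ≤ H := le_trans (by positivity) hH
  have hnet : ∀ n, ∀ v ∈ N n,
      a * |inner ℝ (x - v) z| ≤ 1 / 4 * a ^ 2 * ‖x - v‖ ^ 2 + 4 * H := by
    intro n v hv
    obtain ⟨u, hu, h1, h2⟩ :=
      exists_root_of_increments (chainLevel_nonneg d H) hpar hz n v hv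
    have h2' := h2.trans (sum_chainLevel_le hd hH hε n)
    have h1' : ‖u - v‖ ≤ 2 * ε := by
      refine h1.trans ?_
      have : (0 : ℝ) ≤ 1 / 2 ^ n := by positivity
      nlinarith
    set s := chainLevel d H 0 with hs
    have hs1 : 1 ≤ s := one_le_chainLevel hH0 0
    have hs2 : s ^ 2 ≤ 9 / 4 * H := by
      have := chainLevel_sq_le hd hH 0
      push_cast at this
      linarith
    have hxu : ‖x - u‖ ≤ ‖x - v‖ + 2 * ε := by
      have : x - u = (x - v) - (u - v) := by abel
      rw [this]
      exact (norm_sub_le _ _).trans (by linarith)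
    have hsplit : |inner ℝ (x - v) z| ≤ (‖x - v‖ + 2 * ε) * s + ε * (11 / 2 * H) := by
      have : x - v = (x - u) + (u - v) := by abel
      calc |inner ℝ (x - v) z| ≤ |inner ℝ (x - u) z| + |inner ℝ (u - v) z| := by
            rw [this, inner_add_left]
            exact abs_add_le _ _
        _ ≤ ‖x - u‖ * s + ε * (11 / 2 * H) := add_le_add (hroot u hu) h2'
        _ ≤ _ := by gcongr
    have hmul := mul_le_mul_of_nonneg_left hsplit ha
    -- AM-GM produces the quarter of the quadratic term. The remainders total at most (9/8)(9/4)H +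
    -- (11/32)H = (23/8)H, below 4H.
    have e1 : a * ‖x - v‖ * s ≤ 1 / 4 * a ^ 2 * ‖x - v‖ ^ 2 + s ^ 2 := by
      nlinarith [sq_nonneg (a * ‖x - v‖ / 2 - s)]
    have e2 : a * ε * s ≤ 1 / 16 * s ^ 2 := by
      nlinarith [mul_le_mul_of_nonneg_right haε (by linarith : (0 : ℝ) ≤ s)]
    have e3 : a * ε * (11 / 2 * H) ≤ 1 / 16 * (11 / 2 * H) :=
      mul_le_mul_of_nonneg_right haε (by positivity)
    nlinarith
  intro y hy
  -- The inequality is a closed condition on `y`, and the union of the nets is dense in `M`.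
  have hclosed : IsClosed
      {y : E | a * |inner ℝ (x - y) z| ≤ 1 / 4 * a ^ 2 * ‖x - y‖ ^ 2 + 4 * H} :=
    isClosed_le (by fun_prop) (by fun_prop)
  refine hclosed.closure_subset (Metric.mem_closure_iff.mpr fun r hr => ?_)
  obtain ⟨n, hn⟩ : ∃ n : ℕ, ε / 2 ^ n < r := by
    obtain ⟨n, hn⟩ := pow_unbounded_of_one_lt (ε / r) (one_lt_two (α := ℝ))
    refine ⟨n, ?_⟩
    rw [div_lt_iff₀ (by positivity)]
    rw [div_lt_iff₀ hr] at hn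
    linarith
  obtain ⟨v, hv, hyv⟩ := hcover n y hy
  exact ⟨v, hnet n v hv, hyv.trans_lt hn⟩

/-- This union bound dictates the truncation level: `Λ` and `k * d` pay for the net, `log δ⁻¹` gives
the factor `δ`, and the leftover exponent `-(2 + 2 * k) - d` makes the failure probabilities
summable to `δ`. -/
lemma two_mul_exp_chain_le {d : ℕ} {Λ δ c : ℝ} (hΛ : 0 ≤ Λ) (hδ : 0 < δ) (hδ1 : δ ≤ 1) (k : ℕ)
    (hc : c ≤ Real.exp (Λ + k * d)) :
    c * (2 * Real.exp (-(chainLevel d (Λ + Real.log δ⁻¹) k ^ 2 / 2))) ≤ δ / 2 / 2 ^ k := by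
  have hlog : 0 ≤ Real.log δ⁻¹ := Real.log_nonneg ((one_le_inv₀ hδ).mpr hδ1)
  rw [chainLevel_sq (by linarith)]
  have hexp : Real.exp (-1) ≤ 1 / 2 := by
    rw [Real.exp_neg, inv_eq_one_div]
    exact one_div_le_one_div_of_le two_pos (by linarith [Real.add_one_le_exp 1])
  calc c * (2 * Real.exp (-(2 * (Λ + Real.log δ⁻¹ + (k + 1) * (d + 2)) / 2)))
      ≤ Real.exp (Λ + k * d)
          * (2 * Real.exp (-(2 * (Λ + Real.log δ⁻¹ + (k + 1) * (d + 2)) / 2))) := by gcongr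
    _ = 2 * Real.exp (Real.log δ + (-(2 + 2 * k) - d)) := by
        rw [mul_left_comm, ← Real.exp_add, Real.log_inv]
        congr 2
        ring
    _ ≤ 2 * Real.exp (Real.log δ + ((2 + k : ℕ) : ℝ) * (-1)) := by
        gcongr
        push_cast
        have : (0 : ℝ) ≤ d := by positivity
        have : (0 : ℝ) ≤ k := by positivity
        linarith
    _ = 2 * (δ * Real.exp (-1) ^ (2 + k)) := by
        rw [Real.exp_add, Real.exp_log hδ, Real.exp_nat_mul]
    _ ≤ 2 * (δ * (1 / 2) ^ (2 + k)) := by gcongr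
    _ = δ / 2 / 2 ^ k := by
        rw [pow_add, one_div, inv_pow, inv_pow]
        field_simp

/-- The chaining bound for `⟨X - y, Z⟩`, uniformly over `y ∈ M`, when `Z` is a standard Gaussian
independent of `X` and `M` has nets of size growing exponentially with rate `d`. -/
theorem measure_exists_abs_inner_gt_le {E : Type*} [NormedAddCommGroup E] [InnerProductSpace ℝ E]
    [FiniteDimensional ℝ E] [MeasurableSpace E] [BorelSpace E] {Ω : Type*} [MeasurableSpace Ω]
    {P : Measure Ω} [IsProbabilityMeasure P] {X Z : Ω → E} (hX : Measurable X)
    (hZ : Measurable Z) (hXZ : IndepFun X Z P) (hZlaw : P.map Z = stdGaussian E) {M : Set E}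
    {d : ℕ} {a ε Λ δ : ℝ} (hd : 3 ≤ d) (hΛ : 16 * d ≤ Λ) (ha : 0 ≤ a) (hε : 0 ≤ ε)
    (haε : a * ε ≤ 1 / 16) (hδ : 0 < δ) (hδ1 : δ ≤ 1)
    (hnet : ∀ k : ℕ, ∃ N : Finset E, ↑N ⊆ M ∧ (∀ y ∈ M, ∃ v ∈ N, dist y v ≤ ε / 2 ^ k) ∧
      (N.card : ℝ) ≤ Real.exp (Λ + k * d)) :
    P {ω | ∀ y ∈ M, a * |inner ℝ (X ω - y) (Z ω)|
      ≤ 1 / 4 * a ^ 2 * ‖X ω - y‖ ^ 2 + 4 * (Λ + Real.log δ⁻¹)}ᶜ ≤ ENNReal.ofReal δ := by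
  have hlog : 0 ≤ Real.log δ⁻¹ := Real.log_nonneg ((one_le_inv₀ hδ).mpr hδ1)
  set H := Λ + Real.log δ⁻¹ with hHdef
  have hH : 16 * d ≤ H := by linarith
  choose N hNM hcover hcard using hnet
  -- Membership is placed under the existential so that the parent map is total; off the net its
  -- value is the irrelevant 0.
  have hparex : ∀ k, ∀ v, ∃ u, v ∈ N (k + 1) → u ∈ N k ∧ ‖u - v‖ ≤ ε / 2 ^ k := by
    intro k v
    by_cases hv : v ∈ N (k + 1)
    · obtain ⟨u, hu, h⟩ := hcover k v (hNM _ hv)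
      exact ⟨u, fun _ => ⟨hu, by rwa [← dist_eq_norm, dist_comm]⟩⟩
    · exact ⟨0, fun h => absurd h hv⟩
  choose par hpar using hparex
  -- Only level 0 depends on `ω`. Every direction is a function of `X`, hence independent of `Z`.
  let dir : ℕ → E → Ω → E := fun k v ω => Nat.casesOn k (X ω - v) (fun j => par j v - v)
  let B : ℕ → Set Ω := fun k => ⋃ v ∈ N k,
    {ω | ‖dir k v ω‖ * chainLevel d H k < |inner ℝ (dir k v ω) (Z ω)|}
  have hB : ∀ k, P (B k) ≤ ENNReal.ofReal (δ / 2 / 2 ^ k) := by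
    intro k
    have hone : ∀ v ∈ N k,
        P {ω | ‖dir k v ω‖ * chainLevel d H k < |inner ℝ (dir k v ω) (Z ω)|}
          ≤ ENNReal.ofReal (2 * Real.exp (-(chainLevel d H k ^ 2 / 2))) := by
      intro v _
      have hmeas : ∃ g : E → E, Measurable g ∧ dir k v = g ∘ X := by
        cases k with
        | zero => exact ⟨fun x => x - v, by fun_prop, rfl⟩
        | succ j => exact ⟨fun _ => par j v - v, by fun_prop, rfl⟩
      obtain ⟨g, hg, hgX⟩ := hmeas
      rw [hgX]
      exact measure_abs_inner_gt_le (hg.comp hX) hZ (hXZ.comp hg measurable_id) hZlaw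
        (chainLevel_nonneg d H k)
    calc P (B k) ≤ ∑ v ∈ N k, _ := measure_biUnion_finset_le _ _
      _ ≤ ∑ v ∈ N k, ENNReal.ofReal (2 * Real.exp (-(chainLevel d H k ^ 2 / 2))) :=
          Finset.sum_le_sum hone
      _ = ENNReal.ofReal ((N k).card * (2 * Real.exp (-(chainLevel d H k ^ 2 / 2)))) := by
          rw [Finset.sum_const, nsmul_eq_mul, ← ENNReal.ofReal_natCast,
            ← ENNReal.ofReal_mul (by positivity)]
      _ ≤ ENNReal.ofReal (δ / 2 / 2 ^ k) :=
          ENNReal.ofReal_le_ofReal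
            (two_mul_exp_chain_le (le_trans (by positivity) hΛ) hδ hδ1 k (hcard k))
  have hsub : {ω | ∀ y ∈ M, a * |inner ℝ (X ω - y) (Z ω)|
      ≤ 1 / 4 * a ^ 2 * ‖X ω - y‖ ^ 2 + 4 * H}ᶜ ⊆ ⋃ k, B k := by
    intro ω hω
    by_contra hnot
    refine hω ?_
    simp only [B, Set.mem_iUnion, not_exists, Set.mem_ofPred_eq, not_lt] at hnot
    exact abs_inner_le_of_chain hd hH ha hε haε hcover hpar (fun v hv => hnot 0 v hv)
      fun k v hv => hnot (k + 1) v hv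
  calc _ ≤ P (⋃ k, B k) := measure_mono hsub
    _ ≤ ∑' k, P (B k) := measure_iUnion_le _
    _ ≤ ∑' k : ℕ, ENNReal.ofReal (δ / 2 / 2 ^ k) := ENNReal.tsum_le_tsum hB
    _ = ENNReal.ofReal δ := by
        rw [← ENNReal.ofReal_tsum_of_nonneg (fun k => by positivity) (summable_geometric_two' δ),
          tsum_geometric_two']

/-! ### Volumes of balls -/

lemma euclideanHausdorffMeasure_image_le {X Y : Type*} [EMetricSpace X] [MeasurableSpace X]
    [BorelSpace X] [EMetricSpace Y] [MeasurableSpace Y] [BorelSpace Y] {f : X → Y}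
    (hf : LipschitzWith 1 f) (d : ℕ) (s : Set X) : μHE[d] (f '' s) ≤ μHE[d] s := by
  simp_rw [Measure.euclideanHausdorffMeasure_def, Measure.smul_apply]
  gcongr
  simpa using hf.hausdorffMeasure_image_le (d := d) (by positivity) s

/-- The cube of half-side `ρ / d` lies in the ball by the triangle inequality. This is crude, but
the loss in `d` is later absorbed by `exp Clog`. -/
lemma ofReal_pow_le_volume_ball {d : ℕ} (hd : 0 < d) {ρ : ℝ} (hρ : 0 < ρ) :
    ENNReal.ofReal ((2 * (ρ / d)) ^ d) ≤
      volume (Metric.ball (0 : EuclideanSpace ℝ (Fin d)) ρ) := by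
  have hd' : (0 : ℝ) < d := by exact_mod_cast hd
  have : Nonempty (Fin d) := ⟨⟨0, hd⟩⟩
  have hvol := Real.volume_pi_ball (0 : Fin d → ℝ) (r := ρ / d) (by positivity)
  rw [Fintype.card_fin] at hvol
  rw [← hvol, ← (PiLp.volume_preserving_ofLp (Fin d)).measure_preimage
    Metric.isOpen_ball.measurableSet.nullMeasurableSet]
  refine measure_mono fun x hx => ?_
  have hx' : ∀ i, ‖x i‖ < ρ / d := by
    have := mem_ball_zero_iff.mp (show WithLp.ofLp x ∈ Metric.ball (0 : Fin d → ℝ) (ρ / d) from hx)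
    exact (pi_norm_lt_iff (by positivity)).mp this
  rw [mem_ball_zero_iff]
  calc ‖x‖ = ‖∑ i, EuclideanSpace.single i (x i)‖ := by
        congr 1
        ext j
        simp [Finset.sum_apply]
    _ ≤ ∑ i, ‖EuclideanSpace.single i (x i)‖ := norm_sum_le _ _
    _ < ∑ _i : Fin d, ρ / d := by
        refine Finset.sum_lt_sum_of_nonempty Finset.univ_nonempty fun i _ => ?_
        simpa using hx' i
    _ = ρ := by
        rw [Finset.sum_const, Finset.card_univ, Fintype.card_fin, nsmul_eq_mul]
        field_simp

/-! ### Local geometry of the manifold -/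

variable {D : ℕ}

/-- The range of the derivative of a chart consists of tangent vectors and has dimension `d` by
injectivity. The inclusion suffices for the volume bound; equality is not needed. -/
lemma exists_submodule_le_tangentSpaceAt {k d : ℕ} (hk : 1 ≤ k)
    {M : Set (EuclideanSpace ℝ (Fin D))} (hM : IsSubmanifold k d M)
    {y : EuclideanSpace ℝ (Fin D)} (hy : y ∈ M) :
    ∃ W : Submodule ℝ (EuclideanSpace ℝ (Fin D)),
      W ≤ tangentSpaceAt M y ∧ Module.finrank ℝ W = d := by
  obtain ⟨U, φ, V, hU, h0, hφ0, -, himg, hφ, hinj, -⟩ := hM y hy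
  have hdiff : DifferentiableAt ℝ φ 0 :=
    (hφ.contDiffAt (hU.mem_nhds h0)).differentiableAt (by exact_mod_cast (by omega : k ≠ 0))
  refine ⟨LinearMap.range (fderiv ℝ φ 0).toLinearMap, ?_, ?_⟩
  · rintro _ ⟨v, rfl⟩
    have h := hdiff.hasFDerivAt.hasFDerivWithinAt (s := U) |>.mapsTo_tangent_cone
    rw [tangentConeAt_of_mem_nhds (hU.mem_nhds h0), himg, hφ0] at h
    exact Submodule.subset_span (tangentConeAt_mono Set.inter_subset_left (h (Set.mem_univ v)))
  · rw [LinearMap.finrank_range_of_inj (hinj 0 h0)]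
    simp

lemma IsInverseProjection.norm_sub_le {k : ℕ} (hk : 1 ≤ k) {M : Set (EuclideanSpace ℝ (Fin D))}
    {y : EuclideanSpace ℝ (Fin D)} {Φ : tangentSpaceAt M y → EuclideanSpace ℝ (Fin D)}
    (hΦ : IsInverseProjection M y Φ) {L : ℝ}
    (hL : CkNormLe k Φ (Metric.ball (0 : tangentSpaceAt M y) (reach M / 8)) L)
    {w : tangentSpaceAt M y} (hw : w ∈ Metric.ball (0 : tangentSpaceAt M y) (reach M / 8)) :
    ‖Φ w - y‖ ≤ L * ‖w‖ := by
  have h0 : (0 : tangentSpaceAt M y) ∈ Metric.ball (0 : tangentSpaceAt M y) (reach M / 8) :=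
    Metric.mem_ball_self (dist_nonneg.trans_lt hw)
  have h := (convex_ball (0 : tangentSpaceAt M y) (reach M / 8)).norm_image_sub_le_of_norm_fderiv_le
    (𝕜 := ℝ) (f := Φ) (C := L)
    (fun x hx => (hL.1.contDiffAt (Metric.isOpen_ball.mem_nhds hx)).differentiableAt
      (by exact_mod_cast (by omega : k ≠ 0)))
    (fun x hx => by rw [← norm_iteratedFDeriv_one]; exact hL.2 1 hk x hx) h0 hw
  rwa [hΦ.map_zero, sub_zero] at h

/-- The volume of a small ball of the manifold is at least that of a slightly smaller Euclidean
ball. -/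
lemma volume_ball_le_euclideanHausdorffMeasure {β d : ℕ} (hβ : 1 ≤ β) {τmin LM : ℝ}
    {M : Set (EuclideanSpace ℝ (Fin D))} (hM : ManifoldAssumption β d τmin LM M)
    {y : EuclideanSpace ℝ (Fin D)} (hy : y ∈ M) {r ρ : ℝ} (hρ : ρ ≤ reach M / 8)
    (hρr : LM * ρ ≤ r) :
    volume (Metric.ball (0 : EuclideanSpace ℝ (Fin d)) ρ) ≤ μHE[d] (M ∩ Metric.ball y r) := by
  obtain ⟨W, hWT, hWd⟩ := exists_submodule_le_tangentSpaceAt hβ hM.isSubmanifold hy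
  obtain ⟨Φ, hΦ, hΦL⟩ := hM.inverseProjection y hy
  let b : OrthonormalBasis (Fin d) ℝ W := (stdOrthonormalBasis ℝ W).reindex (finCongr hWd)
  -- Orthogonal projection to `W` in orthonormal coordinates. It does not increase volume, and `Φ`
  -- supplies preimages in `M` for the whole ball: the residual of `Φ v` is orthogonal to the
  -- tangent space, hence to `W`.
  let q : EuclideanSpace ℝ (Fin D) → EuclideanSpace ℝ (Fin d) :=
    fun x => b.repr (W.orthogonalProjectionOnto (x - y))
  have hq : LipschitzWith 1 q := by
    refine LipschitzWith.of_dist_le_mul fun u v => ?_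
    have : q u - q v = b.repr (W.orthogonalProjectionOnto (u - v)) := by
      simp only [q]
      rw [← map_sub, ← map_sub, sub_sub_sub_cancel_right]
    rw [dist_eq_norm, this, LinearIsometryEquiv.norm_map, NNReal.coe_one, one_mul, dist_eq_norm]
    exact W.norm_orthogonalProjectionOnto_apply_le _
  have hsub : Metric.ball (0 : EuclideanSpace ℝ (Fin d)) ρ ⊆ q '' (M ∩ Metric.ball y r) := by
    intro x hx
    rw [mem_ball_zero_iff] at hx
    let w : W := b.repr.symm x
    have hwx : ‖w‖ = ‖x‖ := b.repr.symm.norm_map x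
    let v : tangentSpaceAt M y := ⟨w, hWT w.2⟩
    have hvx : ‖v‖ = ‖x‖ := hwx
    have hv : v ∈ Metric.ball (0 : tangentSpaceAt M y) (reach M / 8) := by
      rw [mem_ball_zero_iff, hvx]
      linarith
    refine ⟨Φ v, ⟨(hΦ.mapsTo v hv).1, ?_⟩, ?_⟩
    · rw [mem_ball_iff_norm]
      refine (hΦ.norm_sub_le hβ hΦL hv).trans_lt (lt_of_lt_of_le ?_ hρr)
      rw [hvx]
      exact mul_lt_mul_of_pos_left hx hM.LM_pos
    · have hort : Φ v - y - w ∈ Wᗮ := by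
        have h1 := (tangentSpaceAt M y).sub_starProjection_mem_orthogonal (Φ v - y)
        have h2 : (tangentSpaceAt M y).starProjection (Φ v - y) = w := by
          rw [Submodule.starProjection_apply]
          exact congrArg Subtype.val (hΦ.proj_apply v hv)
        rw [h2] at h1
        exact Submodule.orthogonal_le hWT h1
      have hproj : W.orthogonalProjectionOnto (Φ v - y) = w := by
        refine Subtype.ext ?_
        rw [← Submodule.starProjection_apply]
        exact Submodule.eq_starProjection_of_mem_orthogonal w.2 hort
      simp only [q]
      rw [hproj]
      exact b.repr.apply_symm_apply x
  calc volume (Metric.ball (0 : EuclideanSpace ℝ (Fin d)) ρ)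
      = μHE[d] (Metric.ball (0 : EuclideanSpace ℝ (Fin d)) ρ) := by
        rw [EuclideanSpace.euclideanHausdorffMeasure_eq_volume]
    _ ≤ μHE[d] (q '' (M ∩ Metric.ball y r)) := measure_mono hsub
    _ ≤ μHE[d] (M ∩ Metric.ball y r) := euclideanHausdorffMeasure_image_le hq d _

/-! ### Mass of small balls and integration against the density -/

section Mass

variable {d α β : ℕ} {τmin LM pmin pmax Lμ Clog : ℝ} {M : Set (EuclideanSpace ℝ (Fin D))}
  {p : EuclideanSpace ℝ (Fin D) → ℝ} {μ : Measure (EuclideanSpace ℝ (Fin D))}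

/-- The mass of a ball of radius `r` centred on the manifold, up to logarithmic complexity. -/
lemma ofReal_exp_neg_mul_pow_le_measure_ball (hβ : 1 ≤ β) (hM : ManifoldAssumption β d τmin LM M)
    (hp : DensityAssumption α d pmin pmax Lμ M p μ) (hC : LogComplexityAssumption d LM Clog M p)
    {y : EuclideanSpace ℝ (Fin D)} (hy : y ∈ M) {r : ℝ} (hr : 0 < r) (hr8 : r ≤ 1 / 8) :
    ENNReal.ofReal (Real.exp (-Clog) * (r * Real.exp (-(2 * Clog))) ^ d)
      ≤ μ (Metric.ball y r) := by
  have hd3 := hM.three_le_dim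
  have hd0 : 0 < d := by omega
  have hd' : (0 : ℝ) < d := by exact_mod_cast hd0
  have hmin := hC.exp_neg_le_min
  have hτ : Real.exp (-Clog) ≤ reach M := hmin.trans (min_le_left _ _)
  have hLM : Real.exp (-Clog) ≤ LM⁻¹ := hmin.trans (min_le_right _ _)
  have hdC : (d : ℝ) < Clog := (le_max_left _ _).trans_lt hC.max_lt
  have hexpd : (d : ℝ) ≤ Real.exp Clog := by linarith [Real.add_one_le_exp Clog]
  have hE := Real.exp_pos (-Clog)
  have hρ0 : 0 < r * Real.exp (-Clog) := by positivity
  -- Shrinking by `exp (-Clog)` meets both constraints, since this factor is at most the reach and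
  -- at most `LM⁻¹`.
  have hvol := volume_ball_le_euclideanHausdorffMeasure hβ hM hy (r := r)
    (ρ := r * Real.exp (-Clog)) (by nlinarith) (by
      have : LM * Real.exp (-Clog) ≤ 1 := by
        calc LM * Real.exp (-Clog) ≤ LM * LM⁻¹ := mul_le_mul_of_nonneg_left hLM hM.LM_pos.le
          _ = 1 := mul_inv_cancel₀ hM.LM_pos.ne'
      nlinarith)
  have hvol' : ENNReal.ofReal ((r * Real.exp (-(2 * Clog))) ^ d)
      ≤ μHE[d] (M ∩ Metric.ball y r) := by
    refine le_trans (ENNReal.ofReal_le_ofReal ?_)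
      ((ofReal_pow_le_volume_ball hd0 hρ0).trans hvol)
    refine pow_le_pow_left₀ (by positivity) ?_ d
    have h2 : Real.exp (-(2 * Clog)) = Real.exp (-Clog) * Real.exp (-Clog) := by
      rw [← Real.exp_add]; congr 1; ring
    have h3 : Real.exp (-Clog) ≤ 1 / d := by
      rw [Real.exp_neg, inv_eq_one_div]
      exact one_div_le_one_div_of_le hd' hexpd
    rw [h2, ← mul_assoc, div_eq_mul_one_div]
    calc r * Real.exp (-Clog) * Real.exp (-Clog) ≤ r * Real.exp (-Clog) * (1 / d) := by gcongr
      _ ≤ 2 * (r * Real.exp (-Clog) * (1 / d)) := by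
          have : 0 ≤ r * Real.exp (-Clog) * (1 / d) := by positivity
          linarith
  have hmeas : MeasurableSet (Metric.ball y r) := Metric.isOpen_ball.measurableSet
  rw [hp.eq_withDensity, withDensity_apply _ hmeas, Measure.restrict_restrict hmeas,
    ENNReal.ofReal_mul (Real.exp_pos _).le, Set.inter_comm]
  calc ENNReal.ofReal (Real.exp (-Clog)) * ENNReal.ofReal ((r * Real.exp (-(2 * Clog))) ^ d)
      ≤ ENNReal.ofReal (Real.exp (-Clog)) * μHE[d] (M ∩ Metric.ball y r) := by gcongr
    _ = ∫⁻ _ in M ∩ Metric.ball y r, ENNReal.ofReal (Real.exp (-Clog)) ∂μHE[d] := by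
        rw [setLIntegral_const]
    _ ≤ ∫⁻ a in M ∩ Metric.ball y r, ENNReal.ofReal (p a) ∂μHE[d] :=
        setLIntegral_mono' (hM.isCompact.measurableSet.inter hmeas) fun x hx =>
          ENNReal.ofReal_le_ofReal (hC.density_bounds x hx.1).1.le

lemma DensityAssumption.ae_mem (hM : IsCompact M)
    (hp : DensityAssumption α d pmin pmax Lμ M p μ) : ∀ᵐ y ∂μ, y ∈ M := by
  rw [hp.eq_withDensity]
  exact (withDensity_absolutelyContinuous _ _).ae_le (ae_restrict_mem hM.measurableSet)

lemma DensityAssumption.setIntegral_mul_eq (hM : IsCompact M)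
    (hp : DensityAssumption α d pmin pmax Lμ M p μ) (g : EuclideanSpace ℝ (Fin D) → ℝ) :
    ∫ y in M, g y * p y ∂μHE[d] = ∫ y, g y ∂μ := by
  have hmeas : AEMeasurable (fun y => ENNReal.ofReal (p y)) (μHE[d].restrict M) :=
    (hp.continuousOn.aemeasurable hM.measurableSet).ennreal_ofReal
  conv_rhs => rw [hp.eq_withDensity]
  rw [integral_withDensity_eq_integral_toReal_smul₀ hmeas (by simp)]
  refine setIntegral_congr_fun hM.measurableSet fun y hy => ?_
  simp only [smul_eq_mul]
  rw [ENNReal.toReal_ofReal (hp.pmin_pos.le.trans (hp.bounds y hy).1), mul_comm]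

end Mass

variable {d α β : ℕ} {τmin LM pmin pmax Lμ Clog : ℝ} {M : Set (EuclideanSpace ℝ (Fin D))}
  {p : EuclideanSpace ℝ (Fin D) → ℝ} {μ : Measure (EuclideanSpace ℝ (Fin D))}

/-! ### Nets of the manifold -/

/-- The mass of balls centred on the manifold at the dyadic scales below `exp (-ℓ) / 16`. -/
lemma ofReal_exp_neg_le_measure_ball (hβ : 1 ≤ β) (hM : ManifoldAssumption β d τmin LM M)
    (hp : DensityAssumption α d pmin pmax Lμ M p μ) (hC : LogComplexityAssumption d LM Clog M p)
    {y : EuclideanSpace ℝ (Fin D)} (hy : y ∈ M) {ℓ : ℝ} (hℓ : 0 ≤ ℓ) (k : ℕ) :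
    ENNReal.ofReal (Real.exp (-(d * (ℓ + 4 * Clog) + k * d)))
      ≤ μ (Metric.ball y (Real.exp (-ℓ) / 16 / 2 ^ k / 2)) := by
  have hd : (3 : ℝ) ≤ d := by exact_mod_cast hM.three_le_dim
  have hC4 : 4 < Clog := (le_max_right _ _).trans_lt hC.max_lt
  have h2k : (1 : ℝ) ≤ 2 ^ k := one_le_pow₀ one_le_two
  have hℓ1 : Real.exp (-ℓ) ≤ 1 := Real.exp_le_one_iff.mpr (by linarith)
  have hr8 : Real.exp (-ℓ) / 16 / 2 ^ k / 2 ≤ 1 / 8 := by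
    have : Real.exp (-ℓ) / 16 / 2 ^ k ≤ Real.exp (-ℓ) / 16 := div_le_self (by positivity) h2k
    linarith
  refine le_trans (ENNReal.ofReal_le_ofReal ?_)
    (ofReal_exp_neg_mul_pow_le_measure_ball hβ hM hp hC hy (by positivity) hr8)
  have he : (2.7 : ℝ) ≤ Real.exp 1 := by linarith [Real.exp_one_gt_d9]
  -- Here 32 = 16 · 2 collects the constants dividing the radius.
  have h32 : (32 : ℝ) * 2 ^ k ≤ Real.exp (4 + k) := by
    have e1 : Real.exp (4 + k) = Real.exp 1 ^ 4 * Real.exp 1 ^ k := by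
      rw [← pow_add, ← Real.exp_nat_mul]
      push_cast
      rw [mul_one]
    rw [e1]
    have : (2 : ℝ) ≤ Real.exp 1 := by linarith
    gcongr
    calc (32 : ℝ) ≤ 2.7 ^ 4 := by norm_num
      _ ≤ Real.exp 1 ^ 4 := by gcongr
  have hr : Real.exp (-ℓ - (4 + k)) ≤ Real.exp (-ℓ) / 16 / 2 ^ k / 2 := by
    rw [Real.exp_sub]
    calc Real.exp (-ℓ) / Real.exp (4 + k) ≤ Real.exp (-ℓ) / (32 * 2 ^ k) := by gcongr
      _ = _ := by field_simp; norm_num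
  calc Real.exp (-(d * (ℓ + 4 * Clog) + k * d))
      ≤ Real.exp (-Clog + d * (-ℓ - (4 + k) + -(2 * Clog))) := by
        gcongr
        -- Of the allowed `4 * d * Clog`, half is spare and pays for `4 * d` and for `Clog`.
        nlinarith
    _ = Real.exp (-Clog) * (Real.exp (-ℓ - (4 + k)) * Real.exp (-(2 * Clog))) ^ d := by
        rw [Real.exp_add, Real.exp_nat_mul, Real.exp_add]
    _ ≤ _ := by gcongr

lemma exists_net (hβ : 1 ≤ β) [IsProbabilityMeasure μ] (hM : ManifoldAssumption β d τmin LM M)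
    (hp : DensityAssumption α d pmin pmax Lμ M p μ) (hC : LogComplexityAssumption d LM Clog M p)
    {ℓ : ℝ} (hℓ : 0 ≤ ℓ) (k : ℕ) :
    ∃ N : Finset (EuclideanSpace ℝ (Fin D)), ↑N ⊆ M ∧
      (∀ y ∈ M, ∃ v ∈ N, dist y v ≤ Real.exp (-ℓ) / 16 / 2 ^ k) ∧
      (N.card : ℝ) ≤ Real.exp (d * (ℓ + 4 * Clog) + k * d) := by
  obtain ⟨N, hN, hcov, hcard⟩ := exists_finset_net (Real.exp_pos _)
    (fun y hy => ofReal_exp_neg_le_measure_ball hβ hM hp hC hy hℓ k) (by positivity)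
  refine ⟨N, hN, hcov, ?_⟩
  rwa [Real.exp_neg, ← div_eq_mul_inv, div_le_one (Real.exp_pos _)] at hcard

/-! ### The posterior density -/

/-- Expanding the square isolates `‖z‖ ^ 2 / 2`, which is free of `y` and so cancels in the
posterior. -/
lemma neg_norm_sq_div_eq {x₀ z y : EuclideanSpace ℝ (Fin D)} {c σ : ℝ} (hσ : 0 < σ) :
    -‖c • x₀ + σ • z - c • y‖ ^ 2 / (2 * σ ^ 2) =
      -(‖z‖ ^ 2 / 2) - 1 / 2 * (c / σ) ^ 2 * ‖x₀ - y‖ ^ 2 - c / σ * inner ℝ (x₀ - y) z := by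
  have h : c • x₀ + σ • z - c • y = c • (x₀ - y) + σ • z := by
    rw [smul_sub]; abel
  rw [h, norm_add_sq_real, inner_smul_left, inner_smul_right, norm_smul, norm_smul, mul_pow,
    mul_pow, Real.norm_eq_abs, Real.norm_eq_abs, sq_abs, sq_abs]
  simp only [conj_trivial]
  field_simp
  ring

/-- Two-sided bounds on the posterior density at `x = c x₀ + σ z`, given a uniform bound on the
noise term `⟨x₀ - y, z⟩` and a lower bound on the mass near `x₀`. -/
lemma log_posteriorDensity_bounds [IsProbabilityMeasure μ] (hM : IsCompact M)
    (hp : DensityAssumption α d pmin pmax Lμ M p μ) (hC : LogComplexityAssumption d LM Clog M p)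
    {t : ℝ} (hσ : 0 < sigmat t) {x₀ z : EuclideanSpace ℝ (Fin D)} {K Λ r : ℝ}
    (har : (ct t / sigmat t) ^ 2 * r ^ 2 ≤ 1)
    (hmass : ENNReal.ofReal (Real.exp (-Λ)) ≤ μ (Metric.ball x₀ r))
    (hK : ∀ y ∈ M, ct t / sigmat t * |inner ℝ (x₀ - y) z|
      ≤ 1 / 4 * (ct t / sigmat t) ^ 2 * ‖x₀ - y‖ ^ 2 + K)
    (hct : 0 ≤ ct t)
    {y : EuclideanSpace ℝ (Fin D)} (hy : y ∈ M) :
    -(2 * K + Clog) - 3 / 4 * (ct t / sigmat t) ^ 2 * ‖x₀ - y‖ ^ 2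
        ≤ Real.log (posteriorDensity d M p t (ct t • x₀ + sigmat t • z) y) ∧
      Real.log (posteriorDensity d M p t (ct t • x₀ + sigmat t • z) y)
        ≤ 2 * K + 1 + Λ + Clog - 1 / 4 * (ct t / sigmat t) ^ 2 * ‖x₀ - y‖ ^ 2 := by
  set a := ct t / sigmat t with ha
  have ha0 : 0 ≤ a := div_nonneg hct hσ.le
  let G : EuclideanSpace ℝ (Fin D) → ℝ := fun y =>
    -‖ct t • x₀ + sigmat t • z - ct t • y‖ ^ 2 / (2 * sigmat t ^ 2)
  have hG : ∀ y, G y = -(‖z‖ ^ 2 / 2) - 1 / 2 * a ^ 2 * ‖x₀ - y‖ ^ 2 - a * inner ℝ (x₀ - y) z :=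
    fun y => neg_norm_sq_div_eq hσ
  have hGup : ∀ y ∈ M, G y ≤ -(‖z‖ ^ 2 / 2) - 1 / 4 * a ^ 2 * ‖x₀ - y‖ ^ 2 + K := by
    intro y hy
    have := mul_le_mul_of_nonneg_left (neg_abs_le (inner ℝ (x₀ - y) z)) ha0
    linarith [hG y, hK y hy]
  have hGlo : ∀ y ∈ M, -(‖z‖ ^ 2 / 2) - 3 / 4 * a ^ 2 * ‖x₀ - y‖ ^ 2 - K ≤ G y := by
    intro y hy
    have := mul_le_mul_of_nonneg_left (le_abs_self (inner ℝ (x₀ - y) z)) ha0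
    linarith [hG y, hK y hy]
  have hGcont : Continuous G := by fun_prop
  have hGint : Integrable (fun y => Real.exp (G y)) μ := by
    refine Integrable.of_bound (C := 1) (Real.continuous_exp.comp hGcont).aestronglyMeasurable
      (ae_of_all _ fun y => ?_)
    rw [Real.norm_eq_abs, Real.abs_exp]
    exact Real.exp_le_one_iff.mpr
      (div_nonpos_of_nonpos_of_nonneg (neg_nonpos.mpr (by positivity)) (by positivity))
  have hae := hp.ae_mem hM
  have hIup : ∫ y, Real.exp (G y) ∂μ ≤ Real.exp (-(‖z‖ ^ 2 / 2) + K) := by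
    calc ∫ y, Real.exp (G y) ∂μ ≤ ∫ _, Real.exp (-(‖z‖ ^ 2 / 2) + K) ∂μ := by
          refine integral_mono_ae hGint (integrable_const _) ?_
          filter_upwards [hae] with y hy
          refine Real.exp_le_exp.mpr ((hGup y hy).trans ?_)
          have : 0 ≤ 1 / 4 * a ^ 2 * ‖x₀ - y‖ ^ 2 := by positivity
          linarith
      _ = _ := by simp
  -- Keep only the ball around `x₀`: there the quadratic term costs at most 3/4, rounded up to 1.
  have hIlo : Real.exp (-(‖z‖ ^ 2 / 2) - 1 - K - Λ) ≤ ∫ y, Real.exp (G y) ∂μ := by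
    have hmass' : Real.exp (-Λ) ≤ μ.real (Metric.ball x₀ r) :=
      (ENNReal.ofReal_le_iff_le_toReal (measure_ne_top _ _)).mp hmass
    calc Real.exp (-(‖z‖ ^ 2 / 2) - 1 - K - Λ)
        = Real.exp (-Λ) * Real.exp (-(‖z‖ ^ 2 / 2) - 1 - K) := by
          rw [← Real.exp_add]; congr 1; ring
      _ ≤ μ.real (Metric.ball x₀ r) * Real.exp (-(‖z‖ ^ 2 / 2) - 1 - K) := by gcongr
      _ = ∫ _ in Metric.ball x₀ r, Real.exp (-(‖z‖ ^ 2 / 2) - 1 - K) ∂μ := by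
          rw [setIntegral_const, smul_eq_mul]
      _ ≤ ∫ y in Metric.ball x₀ r, Real.exp (G y) ∂μ := by
          refine setIntegral_mono_on_ae (integrable_const _).integrableOn hGint.integrableOn
            Metric.isOpen_ball.measurableSet ?_
          filter_upwards [hae] with y hy hyr
          refine Real.exp_le_exp.mpr (le_trans ?_ (hGlo y hy))
          rw [mem_ball_iff_norm'] at hyr
          have : a ^ 2 * ‖x₀ - y‖ ^ 2 ≤ a ^ 2 * r ^ 2 := by gcongr
          linarith
      _ ≤ ∫ y, Real.exp (G y) ∂μ :=
          setIntegral_le_integral hGint (ae_of_all _ fun y => (Real.exp_pos _).le)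
  have hIpos : 0 < ∫ y, Real.exp (G y) ∂μ := (Real.exp_pos _).trans_le hIlo
  have hlogup := (Real.log_le_iff_le_exp hIpos).mpr hIup
  have hloglo := (Real.le_log_iff_exp_le hIpos).mpr hIlo
  obtain ⟨hp1, hp2⟩ := hC.density_bounds y hy
  have hppos : 0 < p y := (Real.exp_pos _).trans hp1
  have hlogp1 := (Real.le_log_iff_exp_le hppos).mpr hp1.le
  have hlogp2 := (Real.log_le_iff_le_exp hppos).mpr hp2.le
  have hpost : Real.log (posteriorDensity d M p t (ct t • x₀ + sigmat t • z) y) =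
      G y + Real.log (p y) - Real.log (∫ y, Real.exp (G y) ∂μ) := by
    have : posteriorDensity d M p t (ct t • x₀ + sigmat t • z) y =
        Real.exp (G y) * p y / ∫ y, Real.exp (G y) ∂μ := by
      rw [← hp.setIntegral_mul_eq hM]
      rfl
    rw [this, Real.log_div (by positivity) hIpos.ne', Real.log_mul (Real.exp_pos _).ne' hppos.ne',
      Real.log_exp]
  rw [hpost]
  constructor
  · linarith [hGlo y hy]
  · linarith [hGup y hy]

/-! ### The noise of the forward process -/

lemma sigmat_pos {t : ℝ} (ht : 0 < t) : 0 < sigmat t :=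
  Real.sqrt_pos.mpr (sub_pos.mpr (by rw [Real.exp_lt_one_iff]; linarith))

lemma ct_pos (t : ℝ) : 0 < ct t := Real.exp_pos _

section Noise

variable {Ω : Type*} {X : ℝ≥0 → Ω → EuclideanSpace ℝ (Fin D)}

/-- The normalized noise `(X(t) - c_t X(0)) / σ_t`. -/
noncomputable def noise (X : ℝ≥0 → Ω → EuclideanSpace ℝ (Fin D)) (t : ℝ≥0) (ω : Ω) :
    EuclideanSpace ℝ (Fin D) :=
  (sigmat t)⁻¹ • (X t ω - ct t • X 0 ω)

lemma ct_smul_add_sigmat_smul_noise {t : ℝ≥0} (ht : 0 < t) (ω : Ω) :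
    ct t • X 0 ω + sigmat t • noise X t ω = X t ω := by
  rw [noise, smul_inv_smul₀ (sigmat_pos (by exact_mod_cast ht)).ne']
  abel

variable [MeasurableSpace Ω] {P : Measure Ω}

lemma IsForwardProcess.measurable_sub_smul (hX : IsForwardProcess P μ X) (t : ℝ≥0) :
    Measurable fun ω => X t ω - ct t • X 0 ω := by
  have h0 := hX.measurable 0
  have ht := hX.measurable t
  fun_prop

lemma IsForwardProcess.measurable_noise (hX : IsForwardProcess P μ X) (t : ℝ≥0) :
    Measurable (noise X t) :=
  (measurable_const_smul (sigmat t)⁻¹).comp (hX.measurable_sub_smul t)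

lemma IsForwardProcess.map_noise (hX : IsForwardProcess P μ X) {t : ℝ≥0} (ht : 0 < t) :
    P.map (noise X t) = stdGaussian (EuclideanSpace ℝ (Fin D)) := by
  have hσ := (sigmat_pos (show (0 : ℝ) < t by exact_mod_cast ht)).ne'
  have h := hX.noise_law 0 t zero_le
  simp only [NNReal.coe_zero, sub_zero] at h
  have h2 := congrArg (Measure.map fun w => (sigmat t)⁻¹ • w) h
  rw [Measure.map_map (by fun_prop) (hX.measurable_sub_smul t), Measure.map_map (by fun_prop) (by fun_prop)] at h2
  have h3 : ((fun w : EuclideanSpace ℝ (Fin D) => (sigmat t)⁻¹ • w) ∘ fun z => sigmat t • z)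
      = id := by
    funext z
    simp [inv_smul_smul₀ hσ]
  rw [h3, Measure.map_id] at h2
  exact h2

lemma IsForwardProcess.indepFun_noise (hX : IsForwardProcess P μ X) (t : ℝ≥0) :
    IndepFun (X 0) (noise X t) P := by
  have h := hX.noise_indep 0 t zero_le
  simp only [NNReal.coe_zero, sub_zero] at h
  have h0 : MeasurableSpace.comap (X 0) inferInstance ≤
      ⨆ r ∈ Set.Iic (0 : ℝ≥0), MeasurableSpace.comap (X r) inferInstance :=
    le_iSup₂_of_le 0 (Set.mem_Iic.mpr le_rfl) le_rfl
  have h1 : IndepFun (fun ω => X t ω - ct t • X 0 ω) (X 0) P :=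
    (IndepFun_iff_Indep _ _ _).mpr (indep_of_indep_of_le_right h h0)
  exact h1.symm.comp measurable_id (measurable_const_smul (sigmat t)⁻¹)

end Noise

end DiffusionManifold

/-! ### The proposition -/

open DiffusionManifold in
theorem proposition3p3 {D d α β : ℕ} (hαβ : α + 1 ≤ β)
    {τmin LM pmin pmax Lμ Clog : ℝ}
    (M : Set (EuclideanSpace ℝ (Fin D))) (p : EuclideanSpace ℝ (Fin D) → ℝ)
    (μ : Measure (EuclideanSpace ℝ (Fin D))) [IsProbabilityMeasure μ]
    (hM : ManifoldAssumption β d τmin LM M)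
    (hp : DensityAssumption α d pmin pmax Lμ M p μ)
    (hC : LogComplexityAssumption d LM Clog M p)
    {Ω : Type*} [MeasurableSpace Ω] (P : Measure Ω) [IsProbabilityMeasure P]
    (X : ℝ≥0 → Ω → EuclideanSpace ℝ (Fin D)) (hX : IsForwardProcess P μ X)
    (t : ℝ≥0) (ht : 0 < t) (δ : ℝ) (hδ : 0 < δ) :
    ENNReal.ofReal (1 - δ) ≤
      P {ω | ∀ y ∈ M,
        -(20 * d * (Real.posLog (sigmat t / ct t)⁻¹ + 4 * Clog)) - 8 * Real.log δ⁻¹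
            - 3 / 4 * (ct t / sigmat t) ^ 2 * ‖X 0 ω - y‖ ^ 2
          ≤ Real.log (posteriorDensity d M p t (X t ω) y) ∧
        Real.log (posteriorDensity d M p t (X t ω) y)
          ≤ 20 * d * (Real.posLog (sigmat t / ct t)⁻¹ + 4 * Clog) + 8 * Real.log δ⁻¹
            - 1 / 4 * (ct t / sigmat t) ^ 2 * ‖X 0 ω - y‖ ^ 2} := by
  rcases le_or_gt 1 δ with hδ1 | hδ1
  · rw [ENNReal.ofReal_of_nonpos (by linarith)]
    exact zero_le
  have hβ : 1 ≤ β := by omega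
  have hσ : 0 < sigmat t := sigmat_pos (by exact_mod_cast ht)
  rw [inv_div]
  set a := ct t / sigmat t with ha
  have ha0 : 0 < a := div_pos (ct_pos t) hσ
  set ℓ := Real.posLog a with hℓdef
  have hℓ : 0 ≤ ℓ := Real.posLog_nonneg
  have hd3 := hM.three_le_dim
  have hd : (3 : ℝ) ≤ d := by exact_mod_cast hd3
  have hC4 : 4 < Clog := (le_max_right _ _).trans_lt hC.max_lt
  have hlog : 0 < Real.log δ⁻¹ := Real.log_pos ((one_lt_inv₀ hδ).mpr hδ1)
  set Λ := d * (ℓ + 4 * Clog) with hΛdef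
  have hΛ : 16 * d ≤ Λ := by nlinarith
  have hΛC : 12 * Clog ≤ Λ := by nlinarith
  have haℓ : a ≤ Real.exp ℓ := by
    rw [← Real.log_le_iff_le_exp ha0]
    exact le_max_right _ _
  have haε : a * (Real.exp (-ℓ) / 16) ≤ 1 / 16 := by
    have : a * Real.exp (-ℓ) ≤ 1 := by
      rw [Real.exp_neg, ← div_eq_mul_inv, div_le_one (Real.exp_pos _)]
      exact haℓ
    linarith
  have hchain := measure_exists_abs_inner_gt_le (hX.measurable 0) (hX.measurable_noise t)
    (hX.indepFun_noise t) (hX.map_noise ht) hd3 hΛ ha0.le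
    (show 0 ≤ Real.exp (-ℓ) / 16 by positivity) haε hδ hδ1.le
    (fun k => exists_net hβ hM hp hC hℓ k)
  have hmem : ∀ᵐ ω ∂P, X 0 ω ∈ M := by
    have := hp.ae_mem hM.isCompact
    rw [← hX.initial_law] at this
    exact ae_of_ae_map (hX.measurable 0).aemeasurable this
  rw [ENNReal.ofReal_sub _ hδ.le, ENNReal.ofReal_one, tsub_le_iff_right, ← measure_univ (μ := P)]
  refine le_trans (measure_mono (t := _ ∪ _) (Set.union_compl_self _).ge)
    -- The inclusion of failure events holds only almost everywhere, because the mass bound needs `X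
    -- 0 ω ∈ M`.
    ((measure_union_le _ _).trans (add_le_add le_rfl (le_trans (measure_mono_ae ?_) hchain)))
  filter_upwards [hmem] with ω hω hbad hgood
  refine hbad fun y hy => ?_
  have hr : a ^ 2 * (Real.exp (-ℓ) / 16 / 2) ^ 2 ≤ 1 := by
    rw [← mul_pow]
    refine pow_le_one₀ (by positivity) ?_
    linarith
  have hmass : ENNReal.ofReal (Real.exp (-Λ)) ≤
      μ (Metric.ball (X 0 ω) (Real.exp (-ℓ) / 16 / 2)) := by
    simpa using ofReal_exp_neg_le_measure_ball hβ hM hp hC hω hℓ 0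
  have hb := log_posteriorDensity_bounds hM.isCompact hp hC hσ hr hmass hgood (ct_pos t).le hy
  rw [ct_smul_add_sigmat_smul_noise ht] at hb
  -- With K = 4(Λ + log δ⁻¹), 2K supplies 8Λ and the full 8 log δ⁻¹; the rest, at most 1 + Λ + Clog,
  -- fits into 12Λ because 12 Clog ≤ Λ.
  have hE : 20 * (d : ℝ) * (ℓ + 4 * Clog) = 20 * Λ := by rw [hΛdef]; ring
  rw [hE]
  constructor
  · linarith [hb.1]
  · linarith [hb.2]
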